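/- Let $R$ be a commutative ring with identity, let $T(A)$ denote the total ring of quotients of a commutative ring $A$, and let $\mathrm{Min}(A)$ be the set of its minimal prime ideals. An ideal $I$ of $R$ is called dense if $\{r\in R : Ir=0\}=0$, regular if it contains a non-zero-divisor, and semi-regular if it contains a finitely generated dense ideal. Let $\mathcal Q$ be the set of finitely generated semi-regular ideals of $R$, and let $$\mathcal Q_0(R)=\{\alpha\in T(R[x]) : I\alpha\subseteq R \text{ for some } I\in\mathcal Q\},$$ a subring of $T(R[x])$. An $R$-module $M$ is $\mathcal Q$-torsion-free if $Im=0$ with $I\in\mathcal Q$, $m\in M$ implies $m=0$. An $R$-module $M$ is called - reg-injective (resp. semireg-injective) if $\mathrm{Ext}^1_R(R/I,M)=0$ for every regular (resp. semi-regular) ideal $I$ of $R$; - Lucas if it is $\mathcal Q$-torsion-free and $\mathrm{Ext}^1_R(R/I,M)=0$ for every $I\in\mathcal Q$; - strongly Lucas if it is $\mathcal Q$-torsion-free and $\mathrm{Ext}^n_R(R/I,M)=0$ for every $I\in\mathcal Q$ and every $n\ge 1$; - $\tau_q$-projective if $\mathrm{Ext}^1_R(M,N)=0$ for every strongly Lucas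 $R$-module $N$. The $\tau_q$-projective dimension of $M$ is the least $n\ge 0$ for which there is an exact sequence $0\to P_n\to\cdots\to P_0\to M\to 0$ with every $P_i$ $\tau_q$-projective ($\infty$ if there is none), and $\tau_q\text{-gl.dim}(R)$ is the supremum of the $\tau_q$-projective dimensions of all $R$-modules. The ring $R$ is $\tau_q$-semisimple if $\tau_q\text{-gl.dim}(R)=0$. **Theorem.** For every commutative ring $R$ the following statements are equivalent. 1. $R$ is a $\tau_q$-semisimple ring. 2. Every $R$-module is $\tau_q$-projective. 3. $T(R[x])$ is a semisimple ring. 4. $R[x]$ is a reduced ring and $\mathrm{Min}(R[x])$ is finite. 5. $T(R)$ is a semisimple ring. 6. $R$ is a reduced ring and $\mathrm{Min}(R)$ is finite. 7. Every reg-injective $R$-module is injective. 8. Every semireg-injective $R$-module is injective. 9. Every Lucas $R$-module is injective. 10. Every strongly Lucas $R$-module is injective. 11. $\mathcal Q_0(R)$ is a semisimple ring. -/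

import Mathlib

open scoped Polynomial

universe u

namespace TauQ

section Ideals

variable {R : Type u} [CommRing R]

/-- An ideal `I` is dense if `(0 :_R I) = 0`. -/
def IsDense (I : Ideal R) : Prop :=
  ∀ r : R, (∀ a ∈ I, a * r = 0) → r = 0

/-- An ideal is regular if it contains a non-zero-divisor. -/
def IsRegular (I : Ideal R) : Prop :=
  ∃ a ∈ I, a ∈ nonZeroDivisors R

/-- An ideal is semi-regular if it contains a finitely generated dense ideal. -/
def IsSemiregular (I : Ideal R) : Prop :=
  ∃ J : Ideal R, J.FG ∧ IsDense J ∧ J ≤ I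

variable (R) in
/-- The set `𝒬` of finitely generated semi-regular ideals of `R`. -/
def setQ : Set (Ideal R) := {I | I.FG ∧ IsSemiregular I}

theorem top_mem_setQ : (⊤ : Ideal R) ∈ setQ R :=
  ⟨⟨{1}, by simp⟩, ⊤, ⟨{1}, by simp⟩, fun r h => by simpa using h 1 trivial, le_rfl⟩

theorem mul_mem_setQ {I J : Ideal R} (hI : I ∈ setQ R) (hJ : J ∈ setQ R) : I * J ∈ setQ R := by
  obtain ⟨hI, A, hA, dA, hAI⟩ := hI
  obtain ⟨hJ, B, hB, dB, hBJ⟩ := hJ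
  refine ⟨hI.mul hJ, A * B, hA.mul hB, fun r h => ?_, Ideal.mul_mono hAI hBJ⟩
  refine dB r fun b hb => dA _ fun a ha => ?_
  rw [← mul_assoc]
  exact h _ (Ideal.mul_mem_mul ha hb)

end Ideals

section RingOfFiniteFractions

variable (R : Type u) [CommRing R]

/-- For an `R`-algebra `S`, the subalgebra of all `α : S` such that `I α` is contained in the image
of `R` for some `I ∈ 𝒬`. -/
def finiteFractionsIn (S : Type u) [CommRing S] [Algebra R S] : Subalgebra R S where
  carrier := {α | ∃ I ∈ setQ R, ∀ a ∈ I, a • α ∈ Set.range (algebraMap R S)}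
  mul_mem' := by
    rintro α β ⟨I, hI, hα⟩ ⟨J, hJ, hβ⟩
    refine ⟨I * J, mul_mem_setQ hI hJ, fun c hc => ?_⟩
    refine Submodule.mul_induction_on hc (fun a ha b hb => ?_) (fun x y hx hy => ?_)
    · obtain ⟨r, hr⟩ := hα a ha
      obtain ⟨s, hs⟩ := hβ b hb
      refine ⟨r * s, ?_⟩
      rw [map_mul, hr, hs, Algebra.smul_def, Algebra.smul_def, Algebra.smul_def, map_mul]
      ring
    · obtain ⟨r, hr⟩ := hx
      obtain ⟨s, hs⟩ := hy
      exact ⟨r + s, by rw [map_add, hr, hs, add_smul]⟩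
  add_mem' := by
    rintro α β ⟨I, hI, hα⟩ ⟨J, hJ, hβ⟩
    refine ⟨I * J, mul_mem_setQ hI hJ, fun c hc => ?_⟩
    have hcI : c ∈ I := (Ideal.mul_le_left : I * J ≤ I) hc
    have hcJ : c ∈ J := (Ideal.mul_le_right : I * J ≤ J) hc
    obtain ⟨r, hr⟩ := hα c hcI
    obtain ⟨s, hs⟩ := hβ c hcJ
    refine ⟨r + s, ?_⟩
    rw [map_add, hr, hs, smul_add]
  algebraMap_mem' r :=
    ⟨⊤, top_mem_setQ, fun a _ => ⟨a * r, by rw [map_mul, Algebra.smul_def]⟩⟩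

/-- The ring of finite fractions
`𝒬₀(R) = {α ∈ T(R[x]) | I α ⊆ R for some I ∈ 𝒬}`, a subring of the total quotient ring `T(R[x])`. -/
noncomputable abbrev finiteFractions : Subalgebra R (FractionRing R[X]) :=
  finiteFractionsIn R (FractionRing R[X])

end RingOfFiniteFractions

section Modules

open CategoryTheory

variable (R : Type u) [CommRing R]

/-- `Ext_R^n(M, N) = 0`. -/
def ExtVanishes (M N : Type u) [AddCommGroup M] [Module R M] [AddCommGroup N] [Module R N]
    (n : ℕ) : Prop :=
  Subsingleton (Abelian.Ext.{u} (ModuleCat.of R M) (ModuleCat.of R N) n)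

/-- `tor_𝒬(M)`. -/
def torQ (M : Type u) [AddCommGroup M] [Module R M] : Set M :=
  {m | ∃ I ∈ setQ R, ∀ a ∈ I, a • m = 0}

/-- `M` is `𝒬`-torsion-free. -/
def IsQTorsionFree (M : Type u) [AddCommGroup M] [Module R M] : Prop :=
  torQ R M = {0}

/-- `M` is reg-injective. -/
def IsRegInjective (M : Type u) [AddCommGroup M] [Module R M] : Prop :=
  ∀ I : Ideal R, IsRegular I → ExtVanishes R (R ⧸ I) M 1

/-- `M` is semireg-injective. -/
def IsSemiregInjective (M : Type u) [AddCommGroup M] [Module R M] : Prop :=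
  ∀ I : Ideal R, IsSemiregular I → ExtVanishes R (R ⧸ I) M 1

/-- `M` is a Lucas module. -/
def IsLucas (M : Type u) [AddCommGroup M] [Module R M] : Prop :=
  IsQTorsionFree R M ∧ ∀ I ∈ setQ R, ExtVanishes R (R ⧸ I) M 1

/-- `M` is a strongly Lucas module. -/
def IsStronglyLucas (M : Type u) [AddCommGroup M] [Module R M] : Prop :=
  IsQTorsionFree R M ∧ ∀ I ∈ setQ R, ∀ n : ℕ, 1 ≤ n → ExtVanishes R (R ⧸ I) M n

/-- `M` is `τ_q`-projective. -/
def IsTauQProjective (M : Type u) [AddCommGroup M] [Module R M] : Prop :=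
  ∀ (N : Type u) [AddCommGroup N] [Module R N], IsStronglyLucas R N → ExtVanishes R M N 1

/-- There is an exact sequence `0 → P_n → ⋯ → P_1 → P_0 → M → 0` with all `P_i`
`τ_q`-projective. The sequence is indexed by all of `ℕ`, with `P_i = 0` for `i > n`. -/
def HasTauQResolution (M : Type u) [AddCommGroup M] [Module R M] (n : ℕ) : Prop :=
  ∃ (P : ℕ → ModuleCat.{u} R) (d : ∀ i, P (i + 1) →ₗ[R] P i) (ε : P 0 →ₗ[R] M),
    (∀ i ≤ n, IsTauQProjective R (P i)) ∧
    (∀ i, n < i → Subsingleton (P i)) ∧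
    (∀ i, Function.Exact (d (i + 1)) (d i)) ∧
    Function.Exact (d 0) ε ∧
    Function.Surjective ε

/-- The `τ_q`-projective dimension of `M`: the length of a shortest finite `τ_q`-projective
resolution, and `⊤` if there is none. -/
noncomputable def tauQpd (M : Type u) [AddCommGroup M] [Module R M] : ℕ∞ :=
  ⨅ (n : ℕ) (_ : HasTauQResolution R M n), (n : ℕ∞)

/-- The `τ_q`-global dimension of `R`. -/
noncomputable def tauQglDim : ℕ∞ :=
  ⨆ M : ModuleCat.{u} R, tauQpd R M

/-- `R` is a `τ_q`-semisimple ring. -/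
def IsTauQSemisimple : Prop := tauQglDim R = 0

end Modules

end TauQ

namespace TauQ

open CategoryTheory nonZeroDivisors

/-! ### Reduced rings with finitely many minimal primes -/

section Rings

variable {R : Type u} [CommRing R]

/-! Everything is tied to condition 6, "`R` is reduced with finitely many minimal primes". This
property passes to subrings of semisimple rings and, by prime avoidance, makes the total quotient
ring semisimple. It ascends to `R[X]`, and under it every dense ideal is regular, so that `𝒬₀(R)` is
just `T(R)`. This settles the ring conditions.

For modules, strongly Lucas implies Lucas, semireg-injective and reg-injective in turn. Under 6 the
ideal `I + Ann I` is regular, so a map on `I`, extended by zero to `Ann I`, extends to `R` when the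
target is reg-injective. Conversely, put `T = T(R[X])`. Every `I ∈ 𝒬` satisfies `I T = T`, so every
`T`-module is strongly Lucas. If these are all injective over `R`, each `J T` is an `R`-direct
summand of `T`, which gives `e ∈ J T` acting as the identity on `J`; such elements force 6. -/

theorem isReduced_of_isSemisimpleRing [IsSemisimpleRing R] : IsReduced R := by
  refine ⟨fun x hx => ?_⟩
  have h : x ∈ Ring.jacobson R := by
    rw [← Ideal.jacobson_bot]
    exact Ideal.radical_le_jacobson hx
  rwa [IsSemisimpleRing.jacobson_eq_bot] at h

/-- Minimal primes of a subring are contracted from primes of the big ring, and a semisimple ring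
has only finitely many primes. -/
theorem isReduced_and_finite_minimalPrimes_of_injective {S : Type*} [CommRing S]
    [IsSemisimpleRing S] (f : R →+* S) (hf : Function.Injective f) :
    IsReduced R ∧ (minimalPrimes R).Finite := by
  have : IsReduced S := isReduced_of_isSemisimpleRing
  refine ⟨isReduced_of_injective f hf, ?_⟩
  refine (Set.finite_range fun P : PrimeSpectrum S => P.asIdeal.comap f).subset fun p hp => ?_
  obtain ⟨P, hP, rfl⟩ := Ideal.exists_comap_eq_of_mem_minimalPrimes_of_injective hf p hp
  exact ⟨⟨P, hP⟩, rfl⟩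

theorem eq_zero_of_forall_mem_minimalPrimes [IsReduced R] {x : R}
    (h : ∀ p ∈ minimalPrimes R, x ∈ p) : x = 0 := by
  have hx : x ∈ sInf (minimalPrimes R) := Submodule.mem_sInf.2 h
  rw [minimalPrimes, Ideal.sInf_minimalPrimes] at hx
  exact (isReduced_iff _).mp ‹_› x hx

theorem mem_nonZeroDivisors_of_notMem_minimalPrimes [IsReduced R] {x : R}
    (h : ∀ p ∈ minimalPrimes R, x ∉ p) : x ∈ R⁰ := by
  rw [mem_nonZeroDivisors_iff_right]
  refine fun y hy => eq_zero_of_forall_mem_minimalPrimes fun p hp => ?_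
  have := hp.isPrime
  exact (this.mem_or_mem (hy ▸ p.zero_mem : y * x ∈ p)).resolve_right (h p hp)

theorem isRegular_of_not_le_minimalPrimes [IsReduced R] (hfin : (minimalPrimes R).Finite)
    {I : Ideal R} (h : ∀ p ∈ minimalPrimes R, ¬ I ≤ p) : IsRegular I := by
  have : ¬ ((I : Set R) ⊆ ⋃ p ∈ minimalPrimes R, (p : Set R)) := fun hsub => by
    -- Prime avoidance tolerates two non-prime members; all are prime here, so `⊤ ⊤` are fillers.
    obtain ⟨p, hp, hle⟩ := (Ideal.subset_union_prime_finite hfin (f := id) ⊤ ⊤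
      fun p hp _ _ => hp.isPrime).1 hsub
    exact h p hp hle
  obtain ⟨a, ha, hna⟩ := Set.not_subset.mp this
  simp only [Set.mem_iUnion, SetLike.mem_coe, exists_prop, not_exists, not_and] at hna
  exact ⟨a, ha, mem_nonZeroDivisors_of_notMem_minimalPrimes hna⟩

/-- Take `c` outside `p` in the intersection of the other minimal primes: `a * c` then lies in all
of them. -/
theorem exists_notMem_mul_eq_zero [IsReduced R] (hfin : (minimalPrimes R).Finite) {p : Ideal R}
    (hp : p ∈ minimalPrimes R) : ∃ c ∉ p, ∀ a ∈ p, a * c = 0 := by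
  have := hp.isPrime
  have hnot : ¬ ((hfin.toFinset.erase p).inf id ≤ p) := by
    rw [Ideal.IsPrime.inf_le' this]
    rintro ⟨q, hq, hle⟩
    simp only [Finset.mem_erase, Set.Finite.mem_toFinset] at hq
    exact hq.1 (le_antisymm hle (hp.2 ⟨hq.2.isPrime, bot_le⟩ hle))
  obtain ⟨c, hc, hcp⟩ := SetLike.not_le_iff_exists.mp hnot
  refine ⟨c, hcp, fun a ha => eq_zero_of_forall_mem_minimalPrimes fun q hq => ?_⟩
  by_cases hqp : q = p
  · exact hqp ▸ p.mul_mem_right _ ha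
  · have hle : (hfin.toFinset.erase p).inf id ≤ q := Finset.inf_le (f := id) (by simp [hqp, hq])
    exact q.mul_mem_left _ (hle hc)

theorem IsDense.isRegular [IsReduced R] (hfin : (minimalPrimes R).Finite) {I : Ideal R}
    (h : IsDense I) : IsRegular I := by
  refine isRegular_of_not_le_minimalPrimes hfin fun p hp hle => ?_
  obtain ⟨c, hc, hpc⟩ := exists_notMem_mul_eq_zero hfin hp
  exact hc (h c (fun a ha => hpc a (hle ha)) ▸ p.zero_mem)

theorem IsDense.mono {I J : Ideal R} (h : IsDense I) (hle : I ≤ J) : IsDense J :=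
  fun r hr => h r fun a ha => hr a (hle ha)

theorem isDense_of_mem_setQ {I : Ideal R} (h : I ∈ setQ R) : IsDense I := by
  obtain ⟨_, J, _, hJ, hle⟩ := h
  exact hJ.mono hle

theorem IsRegular.isSemiregular {I : Ideal R} (h : IsRegular I) : IsSemiregular I := by
  obtain ⟨a, ha, ha'⟩ := h
  refine ⟨Ideal.span {a}, ⟨{a}, by simp⟩, fun r hr => ?_, (Ideal.span_singleton_le_iff_mem I).2 ha⟩
  exact ha'.1 r (hr a (Ideal.mem_span_singleton_self a))

theorem IsSemiregular.exists_le_mem_setQ {I : Ideal R} (h : IsSemiregular I) :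
    ∃ J ∈ setQ R, J ≤ I := by
  obtain ⟨J, hJ, hd, hle⟩ := h
  exact ⟨J, ⟨hJ, J, hJ, hd, le_rfl⟩, hle⟩

/-- An `r` killing `I` lies in `Ann I`; killing that too, it squares to zero. -/
theorem isDense_sup_annihilator [IsReduced R] (I : Ideal R) :
    IsDense (I ⊔ Submodule.annihilator I) := by
  intro r hr
  have h1 : r ∈ Submodule.annihilator I := by
    refine Submodule.mem_annihilator.2 fun a ha => ?_
    rw [smul_eq_mul, mul_comm]
    exact hr a (le_sup_left (a := I) ha)
  exact IsReduced.eq_zero r ⟨2, (sq r).trans (hr r (le_sup_right (a := I) h1))⟩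

/-- A prime of `S` contracts to an ideal of zero divisors, hence to a minimal prime. So `S` has
finitely many primes, all maximal, with intersection zero, and the Chinese remainder theorem makes
it a product of fields. -/
theorem isSemisimpleRing_of_isLocalization_nonZeroDivisors [IsReduced R]
    (hfin : (minimalPrimes R).Finite) (S : Type u) [CommRing S] [Algebra R S]
    [IsLocalization R⁰ S] : IsSemisimpleRing S := by
  have hmin : ∀ P : Ideal S, P.IsPrime → P.comap (algebraMap R S) ∈ minimalPrimes R := by
    intro P hP
    by_contra hcon
    obtain ⟨a, ha, ha'⟩ := isRegular_of_not_le_minimalPrimes hfin (I := P.comap (algebraMap R S))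
      fun p hp hle => hcon <| by
        have hQ : (P.comap (algebraMap R S)).IsPrime := inferInstance
        rwa [le_antisymm hle (hp.2 ⟨hQ, bot_le⟩ hle)]
    exact hP.ne_top (Ideal.eq_top_of_isUnit_mem _ ha (IsLocalization.map_units S ⟨a, ha'⟩))
  have hinj : Function.Injective (Ideal.comap (algebraMap R S)) :=
    (IsLocalization.orderEmbedding R⁰ S).injective
  have hmax : ∀ P : Ideal S, P.IsPrime → P.IsMaximal := by
    intro P hP
    obtain ⟨M, hM, hle⟩ := Ideal.exists_le_maximal P hP.ne_top
    have h1 : P.comap (algebraMap R S) = M.comap (algebraMap R S) :=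
      le_antisymm (Ideal.comap_mono hle) ((hmin M hM.isPrime).2
        ⟨(hmin P hP).isPrime, bot_le⟩ (Ideal.comap_mono hle))
    rwa [hinj h1]
  let Spec := {P : Ideal S | P.IsPrime}
  have : Finite Spec := by
    refine Set.Finite.of_injOn (f := Ideal.comap (algebraMap R S)) hmin hinj.injOn hfin
  have (P : Spec) : P.1.IsMaximal := hmax P.1 P.2
  have (P : Spec) : IsSemisimpleRing (S ⧸ P.1) :=
    let _ := Ideal.Quotient.field P.1; inferInstance
  have hred : IsReduced S := isReduced_localizationPreserves R⁰ S ‹_›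
  have hbot : ⨅ P : Spec, P.1 = ⊥ := by
    rw [← sInf_eq_iInf', ← nilradical_eq_sInf, nilradical_eq_zero]
    rfl
  exact ((RingEquiv.quotientBot S).symm.trans ((Ideal.quotEquivOfEq hbot.symm).trans
    (Ideal.quotientInfRingEquivPiQuotient _ fun I J ne ↦
      Ideal.isCoprime_of_isMaximal <| Subtype.coe_ne_coe.mpr ne))).symm.isSemisimpleRing

theorem isReduced_and_finite_minimalPrimes_polynomial [IsReduced R]
    (hfin : (minimalPrimes R).Finite) :
    IsReduced R[X] ∧ (minimalPrimes R[X]).Finite := by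
  have : Finite (minimalPrimes R) := hfin
  have (p : minimalPrimes R) : p.1.IsPrime := p.2.isPrime
  -- `R[X]` embeds in a finite product of fields, which is semisimple.
  let f : R[X] →+* ∀ p : minimalPrimes R, FractionRing (R ⧸ p.1)[X] :=
    RingHom.pi fun p => (algebraMap (R ⧸ p.1)[X] (FractionRing (R ⧸ p.1)[X])).comp
      (Polynomial.mapRingHom (Ideal.Quotient.mk p.1))
  refine isReduced_and_finite_minimalPrimes_of_injective f
    ((injective_iff_map_eq_zero f).2 fun g hg => ?_)
  ext n
  refine eq_zero_of_forall_mem_minimalPrimes fun p hp => ?_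
  have h1 : algebraMap (R ⧸ p)[X] (FractionRing (R ⧸ p)[X])
      (g.map (Ideal.Quotient.mk p)) = 0 := congrFun hg ⟨p, hp⟩
  rw [FaithfulSMul.algebraMap_eq_zero_iff] at h1
  rw [← Ideal.Quotient.eq_zero_iff_mem, ← Polynomial.coeff_map, h1, Polynomial.coeff_zero]

/-! ### Finite fractions and the extension `R → T(R[X])` -/

variable (R) in
theorem algebraMap_fractionRing_polynomial_injective :
    Function.Injective (algebraMap R (FractionRing R[X])) := by
  rw [IsScalarTower.algebraMap_eq R R[X] (FractionRing R[X])]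
  exact (IsFractionRing.injective R[X] (FractionRing R[X])).comp Polynomial.C_injective

/-- Each `I ∈ 𝒬` contains a non-zero-divisor `a`, so `I α ⊆ R` makes `α` a fraction with denominator
`a`. -/
theorem isLocalization_finiteFractions [IsReduced R] (hfin : (minimalPrimes R).Finite) :
    IsLocalization R⁰ (finiteFractions R) := by
  have hinj := algebraMap_fractionRing_polynomial_injective R
  have hunit : ∀ a ∈ R⁰, IsUnit (algebraMap R (FractionRing R[X]) a) := fun a ha => by
    rw [IsScalarTower.algebraMap_apply R R[X] (FractionRing R[X])]
    refine IsLocalization.map_units (FractionRing R[X]) (⟨_, ?_⟩ : R[X]⁰)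
    exact Polynomial.mem_nonzeroDivisors_of_coeff_mem 0 (by simpa using ha)
  refine ⟨fun ⟨a, ha⟩ => ?_, fun ⟨α, I, hI, hα⟩ => ?_, fun {x y} h => ⟨1, ?_⟩⟩
  · obtain ⟨β, hβ⟩ := (hunit a ha).exists_right_inv
    have hβ' : β ∈ finiteFractions R := by
      refine ⟨Ideal.span {a}, ⟨⟨{a}, by simp⟩, IsRegular.isSemiregular
        ⟨a, Ideal.mem_span_singleton_self a, ha⟩⟩, fun b hb => ?_⟩
      obtain ⟨c, rfl⟩ := Ideal.mem_span_singleton'.1 hb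
      exact ⟨c, by rw [Algebra.smul_def, map_mul, mul_assoc, hβ, mul_one]⟩
    exact IsUnit.of_mul_eq_one ⟨β, hβ'⟩ (Subtype.ext hβ)
  · obtain ⟨a, ha, ha'⟩ := (isDense_of_mem_setQ hI).isRegular hfin
    obtain ⟨r, hr⟩ := hα a ha
    refine ⟨(r, ⟨a, ha'⟩), Subtype.ext ?_⟩
    change α * algebraMap R (FractionRing R[X]) a = algebraMap R (FractionRing R[X]) r
    rw [hr, Algebra.smul_def, mul_comm]
  · rw [hinj (congrArg Subtype.val h)]

/-- Use generators of `I` as the coefficients of a polynomial `f`. By McCoy's theorem a zero divisor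
`f` would be killed by a nonzero constant, which would kill the dense ideal `I`. So `f` becomes a
unit lying in the extended ideal. -/
theorem map_fractionRing_polynomial_eq_top {I : Ideal R} (hI : I ∈ setQ R) :
    I.map (algebraMap R (FractionRing R[X])) = ⊤ := by
  obtain ⟨n, a, ha⟩ := Submodule.fg_iff_exists_fin_generating_family.1 hI.1
  let f : R[X] := ∑ i : Fin n, Polynomial.monomial (i : ℕ) (a i)
  have hcoeff : ∀ i : Fin n, f.coeff i = a i := fun i => by
    simp [f, Polynomial.finsetSum_coeff, Polynomial.coeff_monomial, Fin.val_inj]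
  have hf : f ∈ R[X]⁰ := by
    refine Polynomial.mem_nonZeroDivisors_iff.2 fun r hr => isDense_of_mem_setQ hI r fun b hb => ?_
    have hle : I ≤ Submodule.annihilator (Ideal.span {r}) := by
      rw [← ha]
      refine Submodule.span_le.2 ?_
      rintro _ ⟨i, rfl⟩
      refine (Submodule.mem_annihilator_span_singleton r (a i)).2 ?_
      have := congrArg (Polynomial.coeff · (i : ℕ)) hr
      simpa [hcoeff, mul_comm] using this
    exact (Submodule.mem_annihilator_span_singleton r b).1 (hle hb)
  refine Ideal.eq_top_of_isUnit_mem _ ?_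
    (IsLocalization.map_units (FractionRing R[X]) (⟨f, hf⟩ : R[X]⁰))
  change algebraMap R[X] (FractionRing R[X]) (∑ i : Fin n, Polynomial.monomial (i : ℕ) (a i)) ∈ _
  rw [map_sum]
  refine Ideal.sum_mem _ fun i _ => ?_
  rw [← Polynomial.C_mul_X_pow_eq_monomial, map_mul, Polynomial.C_eq_algebraMap,
    ← IsScalarTower.algebraMap_apply]
  refine Ideal.mul_mem_right _ _ (Ideal.mem_map_of_mem _ ?_)
  rw [← ha]
  exact Submodule.subset_span ⟨i, rfl⟩

/-! ### Ideals whose extension to `T(R[X])` contains a local identity -/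

section Retract

variable (h : ∀ J : Ideal R, ∃ e ∈ J.map (algebraMap R (FractionRing R[X])),
  ∀ a ∈ J, algebraMap R (FractionRing R[X]) a * e = algebraMap R (FractionRing R[X]) a)

/-- Since `e` lies in a prime over `p`, `1 - e ≠ 0`. It kills `p`, hence so do its numerator in
`R[X]` and the coefficients of that numerator. -/
theorem exists_ne_zero_mul_eq_zero_of_retract {p : Ideal R}
    (hp : p ∈ minimalPrimes R) (hpr : ∃ e ∈ p.map (algebraMap R (FractionRing R[X])),
      ∀ a ∈ p, algebraMap R (FractionRing R[X]) a * e = algebraMap R (FractionRing R[X]) a) :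
    ∃ c, c ≠ 0 ∧ ∀ a ∈ p, a * c = 0 := by
  obtain ⟨e, he, hae⟩ := hpr
  obtain ⟨P, hP, rfl⟩ := Ideal.exists_comap_eq_of_mem_minimalPrimes_of_injective
    (algebraMap_fractionRing_polynomial_injective R) p hp
  obtain ⟨g, s, hgs⟩ := IsLocalization.exists_mk'_eq R[X]⁰ (1 - e)
  have hs : algebraMap R[X] (FractionRing R[X]) g =
      (1 - e) * algebraMap R[X] (FractionRing R[X]) s := by
    rw [← hgs, IsLocalization.mk'_spec]
  have hg : g ≠ 0 := by
    rintro rfl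
    rw [IsLocalization.mk'_zero] at hgs
    refine hP.ne_top ((Ideal.eq_top_iff_one _).2 ?_)
    rw [sub_eq_zero.1 hgs.symm]
    exact Ideal.map_comap_le he
  obtain ⟨n, hn⟩ : ∃ n, g.coeff n ≠ 0 := by
    by_contra! hcon
    exact hg (Polynomial.ext hcon)
  refine ⟨g.coeff n, hn, fun a ha => ?_⟩
  have : Polynomial.C a * g = 0 := by
    refine IsFractionRing.injective R[X] (FractionRing R[X]) ?_
    rw [map_mul, hs, Polynomial.C_eq_algebraMap, ← IsScalarTower.algebraMap_apply, map_zero,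
      ← mul_assoc, mul_sub, mul_one, hae a ha, sub_self, zero_mul]
  rw [← Polynomial.coeff_C_mul, this, Polynomial.coeff_zero]

include h in
theorem isReduced_and_finite_minimalPrimes_of_retract :
    IsReduced R ∧ (minimalPrimes R).Finite := by
  have hinj := algebraMap_fractionRing_polynomial_injective R
  have hred : IsReduced R := by
    refine (isReduced_iff_pow_one_lt 2 one_lt_two).2 fun a ha => hinj ?_
    -- With `e = t * a`, `a = a * e = t * a ^ 2 = 0`.
    obtain ⟨e, he, hae⟩ := h (Ideal.span {a})
    rw [Ideal.map_span, Set.image_singleton] at he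
    obtain ⟨t, rfl⟩ := Ideal.mem_span_singleton'.1 he
    rw [← hae a (Ideal.mem_span_singleton_self a), mul_left_comm, ← map_mul, ← sq, ha, map_zero,
      mul_zero]
  refine ⟨hred, ?_⟩
  choose c hc0 hc using fun p : minimalPrimes R => exists_ne_zero_mul_eq_zero_of_retract p.2 (h p.1)
  -- Some `a ∈ q` avoids `p`; `a * c q = 0` puts `c q` in `p`, which `c p` kills.
  have hmul : ∀ p q : minimalPrimes R, p ≠ q → c p * c q = 0 := by
    intro p q hpq
    rw [mul_comm]
    refine hc p _ ?_
    have hnot : ¬ q.1 ≤ p.1 := fun hle =>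
      hpq (Subtype.ext (le_antisymm (p.2.2 ⟨q.2.isPrime, bot_le⟩ hle) hle))
    obtain ⟨a, ha, hap⟩ := SetLike.not_le_iff_exists.1 hnot
    exact (p.2.isPrime.mem_or_mem (hc q a ha ▸ p.1.zero_mem)).resolve_left hap
  obtain ⟨e, he, hae⟩ := h (Ideal.span (Set.range c))
  rw [Ideal.map_span, ← Set.range_comp] at he
  obtain ⟨t, rfl⟩ := Finsupp.mem_span_range_iff_exists_finsupp.1 he
  have : Finite (minimalPrimes R) := by
    -- The identity `e` for the ideal of all `c p` is a finite combination of them. By orthogonality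
    -- it kills `c p` for `p` outside its support, yet it fixes `c p ≠ 0`.
    refine @Finite.of_fintype _ ⟨t.support, fun p => ?_⟩
    by_contra hp
    refine hc0 p (hinj ?_)
    rw [← hae _ (Ideal.subset_span ⟨p, rfl⟩), map_zero, Finsupp.sum, Finset.mul_sum]
    refine Finset.sum_eq_zero fun q hq => ?_
    rw [smul_eq_mul, Function.comp_apply, mul_left_comm, ← map_mul,
      hmul p q (fun hpq => hp (hpq ▸ hq)), map_zero, mul_zero]
  exact this

end Retract

end Rings

/-! ### `Ext`, injectivity and `τ_q`-projectivity -/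

section Modules

variable {R : Type u} [CommRing R]

/-- Long exact sequence of `0 → I → R → R/I → 0`, with `R` projective. -/
theorem extVanishes_quotient_iff (I : Ideal R) (M : Type u) [AddCommGroup M] [Module R M] :
    ExtVanishes R (R ⧸ I) M 1 ↔
      ∀ g : I →ₗ[R] M, ∃ g' : R →ₗ[R] M, ∀ x (hx : x ∈ I), g' x = g ⟨x, hx⟩ := by
  let S : ShortComplex (ModuleCat.{u} R) :=
    ShortComplex.mk (ModuleCat.ofHom I.subtype) (ModuleCat.ofHom I.mkQ) (by ext x; exact (Submodule.Quotient.mk_eq_zero I).2 x.2)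
  have hS : S.ShortExact :=
    { exact := (ShortComplex.ShortExact.moduleCat_exact_iff_function_exact S).2
        (LinearMap.exact_subtype_mkQ I)
      mono_f := (ModuleCat.mono_iff_injective _).2 I.injective_subtype
      epi_g := (ModuleCat.epi_iff_surjective _).2 I.mkQ_surjective }
  constructor
  · intro h g
    have h0 : hS.extClass.comp (Abelian.Ext.mk₀ (ModuleCat.ofHom g)) (add_zero 1) = 0 :=
      @Subsingleton.elim _ h _ _
    obtain ⟨x, hx⟩ := Abelian.Ext.contravariant_sequence_exact₁ hS _ _ _ h0
    obtain ⟨g', rfl⟩ := Abelian.Ext.addEquiv₀.symm.surjective x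
    refine ⟨g'.hom, fun x hxI => ?_⟩
    have hx' : S.f ≫ g' = ModuleCat.ofHom g := by
      apply Abelian.Ext.addEquiv₀.symm.injective
      simpa using hx
    exact congrArg (fun φ => ModuleCat.Hom.hom φ (⟨x, hxI⟩ : I)) hx'
  · intro h
    refine subsingleton_of_forall_eq 0 fun α => ?_
    have hproj : Projective (ModuleCat.of R R) :=
      (IsProjective.iff_projective R).1 inferInstance
    have h0 : (Abelian.Ext.mk₀ S.g).comp α (zero_add 1) = 0 :=
      @Abelian.Ext.eq_zero_of_projective _ _ _ _ _ _ _ hproj _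
    obtain ⟨x, rfl⟩ := Abelian.Ext.contravariant_sequence_exact₃ hS _ α h0 (add_zero 1)
    obtain ⟨g, rfl⟩ := Abelian.Ext.addEquiv₀.symm.surjective x
    obtain ⟨g', hg'⟩ := h g.hom
    have hg : g = S.f ≫ ModuleCat.ofHom g' := by
      ext x
      exact (hg' x.1 x.2).symm
    change hS.extClass.comp (Abelian.Ext.mk₀ g) (add_zero 1) = 0
    rw [hg, ← Abelian.Ext.mk₀_comp_mk₀, ← Abelian.Ext.comp_assoc_of_second_deg_zero,
      hS.extClass_comp, Abelian.Ext.zero_comp]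

theorem injective_iff_extVanishes (N : Type u) [AddCommGroup N] [Module R N] :
    Module.Injective R N ↔ ∀ I : Ideal R, ExtVanishes R (R ⧸ I) N 1 := by
  rw [← Module.Baer.iff_injective]
  simp only [extVanishes_quotient_iff]
  rfl

theorem extVanishes_one_of_injective (M N : Type u) [AddCommGroup M] [Module R M]
    [AddCommGroup N] [Module R N] (h : Module.Injective R N) : ExtVanishes R M N 1 := by
  have : Injective (ModuleCat.of R N) := Module.injective_object_of_injective_module R N
  exact Abelian.Ext.subsingleton_of_injective _ _ 0

theorem extVanishes_of_linearEquiv {M M' N : Type u} [AddCommGroup M] [Module R M]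
    [AddCommGroup M'] [Module R M'] [AddCommGroup N] [Module R N] (e : M ≃ₗ[R] M') {n : ℕ}
    (h : ExtVanishes R M N n) : ExtVanishes R M' N n := by
  refine subsingleton_of_forall_eq 0 fun α => ?_
  have h0 : (Abelian.Ext.mk₀ e.toModuleIso.hom).comp α (zero_add n) = 0 :=
    @Subsingleton.elim _ h _ _
  rw [← Abelian.Ext.mk₀_id_comp α, ← e.toModuleIso.inv_hom_id, ← Abelian.Ext.mk₀_comp_mk₀,
    Abelian.Ext.comp_assoc_of_second_deg_zero, h0, Abelian.Ext.comp_zero]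

theorem isTauQSemisimple_iff :
    IsTauQSemisimple R ↔
      ∀ (M : Type u) [AddCommGroup M] [Module R M], IsTauQProjective R M := by
  constructor
  · intro h M _ _ N _ _ hN
    have h1 : tauQpd R M ≤ 0 := by
      rw [← (h : tauQglDim R = 0)]
      exact le_iSup (fun M : ModuleCat.{u} R => tauQpd R M) (ModuleCat.of R M)
    have h2 : ∃ n, ∃ _ : HasTauQResolution R M n, (n : ℕ∞) < 1 := by
      have : tauQpd R M < 1 := lt_of_le_of_lt h1 zero_lt_one
      simpa only [tauQpd, iInf_lt_iff] using this
    obtain ⟨n, ⟨P, d, ε, hP, hzero, -, hex, hsurj⟩, hn⟩ := h2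
    obtain rfl : n = 0 := by
      have : n < 1 := by exact_mod_cast hn
      omega
    have := hzero 1 one_pos
    -- In a resolution of length zero `P 1 = 0`, so `ε` is an isomorphism `P 0 ≅ M`.
    have hinj : Function.Injective ε := by
      refine (injective_iff_map_eq_zero ε).2 fun x hx => ?_
      obtain ⟨y, rfl⟩ := (hex x).1 hx
      rw [Subsingleton.elim y 0, map_zero]
    exact extVanishes_of_linearEquiv (LinearEquiv.ofBijective ε ⟨hinj, hsurj⟩)
      (hP 0 le_rfl N hN)
  · intro h
    refine le_antisymm (iSup_le fun M => ?_) bot_le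
    refine iInf₂_le_of_le 0 ?_ le_rfl
    refine ⟨fun i => i.casesOn M fun _ => ModuleCat.of R PUnit, fun _ => 0, LinearMap.id,
      fun i _ => h _, fun i hi => ?_, fun i x => ?_, fun x => ?_, fun x => ⟨x, rfl⟩⟩
    · obtain ⟨j, rfl⟩ := Nat.exists_eq_succ_of_ne_zero hi.ne'
      exact inferInstanceAs (Subsingleton PUnit)
    · exact ⟨fun _ => ⟨0, rfl⟩, fun _ => rfl⟩
    · exact ⟨fun hx => ⟨0, hx.symm⟩, fun ⟨_, hy⟩ => hy.symm⟩

theorem forall_isTauQProjective_iff :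
    (∀ (M : Type u) [AddCommGroup M] [Module R M], IsTauQProjective R M) ↔
      ∀ (N : Type u) [AddCommGroup N] [Module R N],
        IsStronglyLucas R N → Module.Injective R N :=
  ⟨fun h N _ _ hN => (injective_iff_extVanishes N).2 fun I => h (R ⧸ I) N hN,
    fun h M _ _ N _ _ hN => extVanishes_one_of_injective M N (h N hN)⟩

/-! ### Lucas-type modules -/

section Classes

variable {M : Type u} [AddCommGroup M] [Module R M]

theorem IsQTorsionFree.eq_zero (h : IsQTorsionFree R M) {I : Ideal R} (hI : I ∈ setQ R) {m : M}
    (hm : ∀ a ∈ I, a • m = 0) : m = 0 := by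
  have : m ∈ torQ R M := ⟨I, hI, hm⟩
  rwa [h] at this

theorem isQTorsionFree_iff :
    IsQTorsionFree R M ↔ ∀ I ∈ setQ R, ∀ m : M, (∀ a ∈ I, a • m = 0) → m = 0 := by
  refine ⟨fun h I hI m hm => h.eq_zero hI hm, fun h => Set.Subset.antisymm ?_ ?_⟩
  · rintro m ⟨I, hI, hm⟩
    exact h I hI m hm
  · rintro _ rfl
    exact ⟨⊤, top_mem_setQ, fun a _ => smul_zero a⟩

theorem IsStronglyLucas.isLucas (h : IsStronglyLucas R M) : IsLucas R M :=
  ⟨h.1, fun I hI => h.2 I hI 1 le_rfl⟩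

/-- Extend the restriction to some `J ∈ 𝒬` inside `I`. On `I` the error is killed by `J`, so
torsion-freeness removes it. -/
theorem IsLucas.isSemiregInjective (h : IsLucas R M) : IsSemiregInjective R M := by
  intro I hI
  obtain ⟨J, hJ, hle⟩ := hI.exists_le_mem_setQ
  rw [extVanishes_quotient_iff]
  intro g
  obtain ⟨g', hg'⟩ := (extVanishes_quotient_iff J M).1 (h.2 J hJ)
    (g.comp (Submodule.inclusion hle))
  refine ⟨g', fun x hx => sub_eq_zero.1 (h.1.eq_zero hJ fun a ha => ?_)⟩
  have h1 : a • g' x = g ⟨a * x, I.mul_mem_left a hx⟩ := by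
    rw [← map_smul, smul_eq_mul]
    exact hg' (a * x) (J.mul_mem_right x ha)
  have h2 : a • g ⟨x, hx⟩ = g ⟨a * x, I.mul_mem_left a hx⟩ := by
    rw [← map_smul]
    rfl
  rw [smul_sub, h1, h2, sub_self]

theorem IsSemiregInjective.isRegInjective (h : IsSemiregInjective R M) : IsRegInjective R M :=
  fun I hI => h I hI.isSemiregular

theorem IsRegInjective.injective [IsReduced R] (hfin : (minimalPrimes R).Finite)
    (h : IsRegInjective R M) : Module.Injective R M := by
  rw [injective_iff_extVanishes]
  intro I
  rw [extVanishes_quotient_iff]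
  intro g
  have hdisj : Disjoint I (Submodule.annihilator I) := by
    rw [Submodule.disjoint_def]
    exact fun x hx hx' => IsReduced.eq_zero x ⟨2, (sq x).trans (Submodule.mem_annihilator.1 hx' x hx)⟩
  obtain ⟨g', hg'⟩ := (extVanishes_quotient_iff _ M).1
    (h _ ((isDense_sup_annihilator I).isRegular hfin))
    (LinearPMap.sup ⟨I, g⟩ ⟨Submodule.annihilator I, 0⟩
      (LinearPMap.sup_h_of_disjoint _ _ hdisj)).toFun
  refine ⟨g', fun x hx => ?_⟩
  rw [hg' x (le_sup_left (a := I) hx)]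
  have := LinearPMap.sup_apply (f := ⟨I, g⟩) (g := ⟨Submodule.annihilator I, 0⟩)
    (LinearPMap.sup_h_of_disjoint _ _ hdisj) (⟨x, hx⟩ : I) (0 : Submodule.annihilator I)
    ⟨x, le_sup_left (a := I) hx⟩ (by simp)
  exact this.trans (add_zero _)

/-- If `I S = S` and `M` is an `S`-module, then `Ext_R^n(R/I, M)` is both killed by `I` and acted on
by `S`, hence zero. -/
theorem extVanishes_of_map_eq_top {S : Type u} [CommRing S] [Algebra R S] [Module S M]
    [IsScalarTower R S M] {I : Ideal R} (hI : I.map (algebraMap R S) = ⊤) (n : ℕ) :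
    ExtVanishes R (R ⧸ I) M n := by
  refine subsingleton_of_forall_eq 0 fun α => ?_
  -- For `t` from `I`, the scalar moves across `Ext` to `R/I`, where it is zero; the case `t = 1`
  -- finishes.
  have key : ∀ t ∈ I.map (algebraMap R S),
      α.comp (Abelian.Ext.mk₀ (ModuleCat.ofHom (Algebra.lsmul R R M t))) (add_zero n) = 0 := by
    intro t ht
    induction ht using Submodule.span_induction with
    | mem t ht =>
      obtain ⟨a, ha, rfl⟩ := ht
      have h1 : ModuleCat.ofHom (Algebra.lsmul R R M (algebraMap R S a)) =
          a • 𝟙 (ModuleCat.of R M) := by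
        ext m
        simp
      have h2 : a • 𝟙 (ModuleCat.of R (R ⧸ I)) = 0 := by
        ext
        change a • (1 : R ⧸ I) = 0
        rw [Algebra.smul_def, mul_one]
        exact Ideal.Quotient.eq_zero_iff_mem.2 ha
      rw [h1, ← Abelian.Ext.smul_eq_comp_mk₀, ← Abelian.Ext.mk₀_id_comp α,
        ← Abelian.Ext.smul_comp, ← Abelian.Ext.mk₀_smul, h2, Abelian.Ext.mk₀_zero,
        Abelian.Ext.zero_comp]
    | zero => simp
    | add s t _ _ hs ht =>
      rw [map_add, ModuleCat.ofHom_add, Abelian.Ext.mk₀_add, Abelian.Ext.comp_add, hs, ht,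
        add_zero]
    | smul s t _ ht =>
      have h1 : ModuleCat.ofHom (Algebra.lsmul R R M (s • t)) =
          ModuleCat.ofHom (Algebra.lsmul R R M t) ≫ ModuleCat.ofHom (Algebra.lsmul R R M s) := by
        ext m
        simp
      rw [h1, ← Abelian.Ext.mk₀_comp_mk₀, ← Abelian.Ext.comp_assoc_of_third_deg_zero, ht,
        Abelian.Ext.zero_comp]
  have h1 := key 1 (hI ▸ Submodule.mem_top)
  rw [map_one] at h1
  rwa [← Abelian.Ext.comp_mk₀_id α]

theorem isStronglyLucas_of_map_eq_top {S : Type u} [CommRing S] [Algebra R S] [Module S M]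
    [IsScalarTower R S M] (h : ∀ I ∈ setQ R, I.map (algebraMap R S) = ⊤) :
    IsStronglyLucas R M := by
  refine ⟨isQTorsionFree_iff.2 fun I hI m hm => ?_, fun I hI n _ =>
    extVanishes_of_map_eq_top (h I hI) n⟩
  have hle : I.map (algebraMap R S) ≤ Submodule.annihilator (Submodule.span S {m}) := by
    refine Ideal.map_le_iff_le_comap.2 fun a ha => ?_
    rw [Ideal.mem_comap, Submodule.mem_annihilator_span_singleton, algebraMap_smul]
    exact hm a ha
  have h1 : (1 : S) ∈ Submodule.annihilator (Submodule.span S {m}) :=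
    hle (h I hI ▸ Submodule.mem_top)
  rwa [Submodule.mem_annihilator_span_singleton, one_smul] at h1

end Classes

/-- Injectivity splits the inclusion of the extended ideal into `S`; the image of `1` under the
retraction is `e`. -/
theorem exists_retract_of_injective {S : Type u} [CommRing S] [Algebra R S] (J : Ideal R)
    (h : Module.Injective R (J.map (algebraMap R S))) :
    ∃ e ∈ J.map (algebraMap R S), ∀ a ∈ J, algebraMap R S a * e = algebraMap R S a := by
  let ι : J.map (algebraMap R S) →ₗ[R] S := (J.map (algebraMap R S)).subtype.restrictScalars R
  obtain ⟨π, hπ⟩ := h.out ι Subtype.val_injective LinearMap.id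
  refine ⟨π 1, (π 1).2, fun a ha => ?_⟩
  have h1 := hπ ⟨algebraMap R S a, Ideal.mem_map_of_mem _ ha⟩
  have h2 : π (algebraMap R S a) = a • π 1 := by
    rw [← map_smul, Algebra.algebraMap_eq_smul_one]
  rw [← Algebra.smul_def]
  calc a • (π 1 : S) = ((a • π 1 : J.map (algebraMap R S)) : S) := rfl
    _ = (π (algebraMap R S a) : S) := by rw [h2]
    _ = algebraMap R S a := congrArg Subtype.val h1

theorem isReduced_and_finite_minimalPrimes_of_isStronglyLucas
    (h : ∀ (N : Type u) [AddCommGroup N] [Module R N],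
      IsStronglyLucas R N → Module.Injective R N) :
    IsReduced R ∧ (minimalPrimes R).Finite :=
  isReduced_and_finite_minimalPrimes_of_retract fun J => exists_retract_of_injective J <|
    h _ (isStronglyLucas_of_map_eq_top (S := FractionRing R[X])
      fun _ hI => map_fractionRing_polynomial_eq_top hI)

end Modules

end TauQ

theorem theorem4p3 (R : Type u) [CommRing R] :
    List.TFAE [
      TauQ.IsTauQSemisimple R,
      ∀ (M : Type u) [AddCommGroup M] [Module R M], TauQ.IsTauQProjective R M,
      IsSemisimpleRing (FractionRing R[X]),
      IsReduced R[X] ∧ (minimalPrimes R[X]).Finite,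
      IsSemisimpleRing (FractionRing R),
      IsReduced R ∧ (minimalPrimes R).Finite,
      ∀ (M : Type u) [AddCommGroup M] [Module R M],
        TauQ.IsRegInjective R M → Module.Injective R M,
      ∀ (M : Type u) [AddCommGroup M] [Module R M],
        TauQ.IsSemiregInjective R M → Module.Injective R M,
      ∀ (M : Type u) [AddCommGroup M] [Module R M],
        TauQ.IsLucas R M → Module.Injective R M,
      ∀ (M : Type u) [AddCommGroup M] [Module R M],
        TauQ.IsStronglyLucas R M → Module.Injective R M,
      IsSemisimpleRing (TauQ.finiteFractions R)] := by
  tfae_have 1 ↔ 2 := TauQ.isTauQSemisimple_iff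
  tfae_have 2 ↔ 10 := TauQ.forall_isTauQProjective_iff
  tfae_have 7 → 8 := fun h M _ _ hM => h M hM.isRegInjective
  tfae_have 8 → 9 := fun h M _ _ hM => h M hM.isSemiregInjective
  tfae_have 9 → 10 := fun h M _ _ hM => h M hM.isLucas
  tfae_have 10 → 6 := TauQ.isReduced_and_finite_minimalPrimes_of_isStronglyLucas
  tfae_have 6 → 7 := fun ⟨_, hfin⟩ M _ _ hM => hM.injective hfin
  tfae_have 6 → 4 := fun ⟨_, hfin⟩ => TauQ.isReduced_and_finite_minimalPrimes_polynomial hfin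
  tfae_have 4 → 3 := fun ⟨_, hfin⟩ =>
    TauQ.isSemisimpleRing_of_isLocalization_nonZeroDivisors hfin _
  tfae_have 3 → 6 := fun _ => TauQ.isReduced_and_finite_minimalPrimes_of_injective _
    (TauQ.algebraMap_fractionRing_polynomial_injective R)
  tfae_have 6 → 5 := fun ⟨_, hfin⟩ =>
    TauQ.isSemisimpleRing_of_isLocalization_nonZeroDivisors hfin _
  tfae_have 5 → 6 := fun _ => TauQ.isReduced_and_finite_minimalPrimes_of_injective _
    (IsFractionRing.injective R (FractionRing R))
  tfae_have 6 → 11 := fun ⟨_, hfin⟩ =>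
    have := TauQ.isLocalization_finiteFractions hfin
    TauQ.isSemisimpleRing_of_isLocalization_nonZeroDivisors hfin _
  tfae_have 11 → 6 := fun _ => TauQ.isReduced_and_finite_minimalPrimes_of_injective
    (algebraMap R (TauQ.finiteFractions R)) fun _ _ h =>
      TauQ.algebraMap_fractionRing_polynomial_injective R (congrArg Subtype.val h)
  tfae_finish
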